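/- Let $G$ be a finite simple connected non-complete graph that is strongly regular with parameters $(v,k,\lambda,\mu)$: it has $v$ vertices, is $k$-regular, any two adjacent vertices have exactly $\lambda$ common neighbours, and any two distinct non-adjacent vertices have exactly $\mu$ common neighbours. Suppose that $\max(\lambda,\mu)\le k/4$. Then there is a set $S\subseteq V(G)$ such that $G\setminus S$ is disconnected and every connected component of $G\setminus S$ has at least two vertices, and the minimum size $\kappa_2(G)$ of such a set is $$\kappa_2(G)=2k-\lambda-2.$$ -/

import Mathlib

/-- The removal of the vertex set `S` disconnects `G` into non-singleton components: the graph
induced on the complement of `S` has at least two connected components, and each of its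
components has at least two vertices. -/
def SimpleGraph.DisconnectsIntoNonsingletons {V : Type*} (G : SimpleGraph V) (S : Finset V) :
    Prop :=
  Nontrivial (G.induce {x : V | x ∉ S}).ConnectedComponent ∧
    ∀ C : (G.induce {x : V | x ∉ S}).ConnectedComponent, C.supp.Nontrivial

/-- `G.IsKappaTwo m` says that `κ₂(G)` exists and equals `m`: the minimum size of a vertex set
whose removal disconnects `G` into non-singleton components is attained and equals `m`. The
value is an integer, so that it can be compared with a difference free of truncation. -/
def SimpleGraph.IsKappaTwo {V : Type*} (G : SimpleGraph V) (m : ℤ) : Prop :=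
  IsLeast {s : ℤ | ∃ S : Finset V, G.DisconnectsIntoNonsingletons S ∧ (S.card : ℤ) = s} m

/-!
The open neighbourhood of an edge has `2k - λ - 2` vertices, and deleting it isolates that edge.

Conversely, let a set `S` of fewer than `2k - λ - 2` vertices separate the shores `A` and `B`, each
containing an edge. Then `S` cannot contain the whole open neighbourhood of an edge of `A`, so `A`
contains three vertices on a path, whose neighbourhoods lie in `A ∪ S`; inclusion-exclusion gives
`|A| ≥ k / 2 + 3`, and likewise for `B`. On the other hand `N = 2 Adj - (λ - μ) I` satisfies
`N² = Δ I + 4 μ J` with `Δ = (λ - μ)² + 4 (k - μ)`, and Cauchy-Schwarz for `N 1_B`, which vanishes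
on `A`, gives `4 μ |A| |B| ≤ Δ |S|`. The two estimates are incompatible.
-/

open Finset

namespace KappaTwo

section Components

open SimpleGraph ConnectedComponent

variable {V : Type*} {G : SimpleGraph V}

theorem forall_supp_nontrivial_iff :
    (∀ C : G.ConnectedComponent, C.supp.Nontrivial) ↔ ∀ x, ∃ y, G.Adj x y := by
  refine ⟨fun h x ↦ ?_, fun h ↦ ConnectedComponent.forall.2 fun x ↦ ?_⟩
  · set C := G.connectedComponentMk x
    have : Nontrivial C := Set.nontrivial_coe_sort.2 (h C)
    obtain ⟨y, hxy⟩ := C.connected_toSimpleGraph.preconnected.exists_adj_of_nontrivial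
      ⟨x, connectedComponentMk_mem⟩
    exact ⟨y, hxy⟩
  · obtain ⟨y, hxy⟩ := h x
    exact ⟨x, connectedComponentMk_mem, y, (connectedComponentMk_eq_of_adj hxy).symm, hxy.ne⟩

theorem nontrivial_connectedComponent_iff :
    Nontrivial G.ConnectedComponent ↔
      ∃ A : Set V, A.Nonempty ∧ Aᶜ.Nonempty ∧ Gᶜ.IsCompleteBetween A Aᶜ := by
  constructor
  · rintro ⟨C, D, hCD⟩
    obtain ⟨y, hy⟩ := D.nonempty_supp
    refine ⟨C.supp, C.nonempty_supp, ⟨y, fun hyC ↦ hCD (eq_of_common_vertex hyC hy)⟩,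
      fun x hx y hy ↦ ⟨fun hxy ↦ hy (hxy ▸ hx), fun hxy ↦ hy (C.mem_supp_of_adj_mem_supp hx hxy)⟩⟩
  · rintro ⟨A, ⟨x, hx⟩, ⟨y, hy⟩, hA⟩
    refine ⟨G.connectedComponentMk x, G.connectedComponentMk y, fun hxy ↦ ?_⟩
    obtain ⟨p⟩ := ConnectedComponent.exact hxy
    obtain ⟨d, -, hd, hd'⟩ := p.exists_boundary_dart A hx hy
    exact (hA hd hd').2 d.adj

theorem disconnectsIntoNonsingletons_iff {S : Finset V} :
    G.DisconnectsIntoNonsingletons S ↔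
      (∃ A B : Set V, A.Nonempty ∧ B.Nonempty ∧ Gᶜ.IsCompleteBetween A B ∧ A ∪ B = (S : Set V)ᶜ) ∧
        ∀ x ∉ S, ∃ y ∉ S, G.Adj x y := by
  refine and_congr ?_ ?_
  · rw [nontrivial_connectedComponent_iff]
    constructor
    · rintro ⟨A, hA, hA', hAA'⟩
      refine ⟨Subtype.val '' A, Subtype.val '' Aᶜ, hA.image _, hA'.image _, ?_, ?_⟩
      · rintro _ ⟨x, hx, rfl⟩ _ ⟨y, hy, rfl⟩
        exact ⟨Subtype.val_injective.ne (hAA' hx hy).1, (hAA' hx hy).2⟩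
      · rw [← Set.image_union, Set.union_compl_self, Set.image_univ, Subtype.range_coe]
        rfl
    · rintro ⟨A, B, ⟨x, hx⟩, ⟨y, hy⟩, hAB, hS⟩
      have hdisj : Disjoint A B := hAB.disjoint
      have hsub : ∀ z : {x | x ∉ S}, z.1 ∈ A ∪ B := fun z ↦ hS ▸ z.2
      have hxS : x ∈ (S : Set V)ᶜ := hS ▸ Or.inl hx
      have hyS : y ∈ (S : Set V)ᶜ := hS ▸ Or.inr hy
      refine ⟨Subtype.val ⁻¹' A, ⟨⟨x, hxS⟩, hx⟩, ⟨⟨y, hyS⟩, hdisj.notMem_of_mem_right hy⟩, ?_⟩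
      intro a ha b hb
      have hab : Gᶜ.Adj a.1 b.1 := hAB ha ((hsub b).resolve_left hb)
      exact ⟨fun h ↦ hab.1 (congrArg _ h), hab.2⟩
  · rw [forall_supp_nontrivial_iff]
    simp

end Components

section Counting

variable {V : Type*} [Fintype V] {G : SimpleGraph V} [DecidableRel G.Adj]
  {n k ℓ μ : ℕ} {x y z : V}

theorem mu_pos_of_connected (h : G.IsSRGWith n k ℓ μ) (hconn : G.Connected) (hG : G ≠ ⊤) :
    0 < μ := by
  obtain ⟨u, w, hne, hadj⟩ := SimpleGraph.ne_top_iff_exists_not_adj.1 hG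
  obtain ⟨p, hp⟩ := (hconn u w).exists_walk_length_eq_dist
  obtain ⟨x, y, z, hxy, hyz, hxz, hne⟩ :=
    SimpleGraph.Walk.exists_adj_adj_not_adj_ne hp (hconn.one_lt_dist_of_ne_of_not_adj hne hadj)
  rw [← h.of_not_adj hne hxz, Fintype.card_pos_iff]
  exact ⟨y, hxy, hyz.symm⟩

variable [DecidableEq V]

theorem card_inter_neighborFinset :
    #(G.neighborFinset x ∩ G.neighborFinset y) = Fintype.card (G.commonNeighbors x y) := by
  rw [← Set.toFinset_card]
  congr 1
  ext z
  simp [SimpleGraph.mem_commonNeighbors]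

theorem card_inter_neighborFinset_le_max (h : G.IsSRGWith n k ℓ μ) (hxy : x ≠ y) :
    #(G.neighborFinset x ∩ G.neighborFinset y) ≤ max ℓ μ := by
  rw [card_inter_neighborFinset]
  by_cases hadj : G.Adj x y
  · exact (h.of_adj x y hadj).trans_le (le_max_left ℓ μ)
  · exact (h.of_not_adj hxy hadj).trans_le (le_max_right ℓ μ)

theorem card_union_neighborFinset_add (h : G.IsSRGWith n k ℓ μ) (hxy : G.Adj x y) :
    #(G.neighborFinset x ∪ G.neighborFinset y) + ℓ = 2 * k := by
  have hinter : #(G.neighborFinset x ∩ G.neighborFinset y) = ℓ := by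
    rw [card_inter_neighborFinset, h.of_adj x y hxy]
  rw [← hinter, card_union_add_card_inter, G.card_neighborFinset_eq_degree,
    G.card_neighborFinset_eq_degree, h.regular x, h.regular y, two_mul]

variable (G) in
/-- The open neighbourhood of the edge `xy`: the vertices other than `x` and `y` that are adjacent
to `x` or to `y`. Its deletion turns the edge into a connected component. -/
def edgeNeighborhood (x y : V) : Finset V :=
  (G.neighborFinset x ∪ G.neighborFinset y) \ {x, y}

theorem mem_edgeNeighborhood :
    z ∈ edgeNeighborhood G x y ↔ (G.Adj x z ∨ G.Adj y z) ∧ z ≠ x ∧ z ≠ y := by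
  simp [edgeNeighborhood]

theorem card_edgeNeighborhood_add (h : G.IsSRGWith n k ℓ μ) (hxy : G.Adj x y) :
    #(edgeNeighborhood G x y) + ℓ + 2 = 2 * k := by
  have hsub : {x, y} ⊆ G.neighborFinset x ∪ G.neighborFinset y := by
    simp [insert_subset_iff, hxy, hxy.symm]
  have hunion := card_union_neighborFinset_add h hxy
  have hsdiff := card_sdiff_add_card_eq_card hsub
  rw [card_pair hxy.ne] at hsdiff
  rw [edgeNeighborhood]
  omega

theorem three_mul_le_card_union_neighborFinset (h : G.IsSRGWith n k ℓ μ) (hxy : G.Adj x y)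
    (hz : z ∈ edgeNeighborhood G x y) :
    3 * k ≤
      #(G.neighborFinset x ∪ G.neighborFinset y ∪ G.neighborFinset z) + 2 * ℓ + max ℓ μ := by
  obtain ⟨hadj, hzx, hzy⟩ := mem_edgeNeighborhood.1 hz
  have hxyz := card_union_add_card_inter (G.neighborFinset x ∪ G.neighborFinset y)
    (G.neighborFinset z)
  have hinter := card_union_le (G.neighborFinset x ∩ G.neighborFinset z)
    (G.neighborFinset y ∩ G.neighborFinset z)
  rw [← union_inter_distrib_right] at hinter
  have hxz := card_inter_neighborFinset_le_max h hzx.symm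
  have hyz := card_inter_neighborFinset_le_max h hzy.symm
  have hℓ : #(G.neighborFinset x ∩ G.neighborFinset z) = ℓ ∨
      #(G.neighborFinset y ∩ G.neighborFinset z) = ℓ := by
    simp only [card_inter_neighborFinset]
    exact hadj.imp (h.of_adj x z) (h.of_adj y z)
  have hxy' := card_union_neighborFinset_add h hxy
  have hz' : #(G.neighborFinset z) = k := h.regular z
  omega

theorem three_mul_le_card_compl (h : G.IsSRGWith n k ℓ μ) {A B : Finset V}
    (hAB : Gᶜ.IsCompleteBetween A B) (hx : x ∈ A) (hy : y ∈ A) (hxy : G.Adj x y)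
    (hS : #(A ∪ B)ᶜ + ℓ + 2 < 2 * k) : 3 * k ≤ #Bᶜ + 2 * ℓ + max ℓ μ := by
  have hN : ∀ a ∈ A, G.neighborFinset a ⊆ Bᶜ := fun a ha b hab ↦ mem_compl.2 fun hb ↦
    (hAB ha hb).2 ((G.mem_neighborFinset a b).1 hab)
  obtain ⟨z, hz, hzS⟩ : ∃ z ∈ edgeNeighborhood G x y, z ∉ (A ∪ B)ᶜ :=
    exists_mem_notMem_of_card_lt_card (by have := card_edgeNeighborhood_add h hxy; omega)
  have hxyB : G.neighborFinset x ∪ G.neighborFinset y ⊆ Bᶜ := union_subset (hN x hx) (hN y hy)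
  have hzA : z ∈ A := by
    have hzB : z ∉ B := mem_compl.1 (hxyB (sdiff_subset hz))
    simpa [hzB] using hzS
  have hcard := card_le_card (union_subset hxyB (hN z hzA))
  have hpath := three_mul_le_card_union_neighborFinset h hxy hz
  omega

end Counting

section CauchySchwarz

open Matrix

theorem sq_colSum_mul_card_le {ι κ R : Type*} [Fintype ι] [DecidableEq ι] [DecidableEq κ]
    [CommRing R] [LinearOrder R] [IsStrictOrderedRing R] {N : Matrix ι κ R} {r q s : R}
    (hN : Nᵀ * N = r • 1 + q • of fun _ _ ↦ 1) (hs : ∀ j, ∑ i, N i j = s)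
    {A : Finset ι} {B : Finset κ} (hB : B.Nonempty) (hAB : ∀ i ∈ A, ∀ j ∈ B, N i j = 0) :
    s ^ 2 * #B ≤ #Aᶜ * (r + q * #B) := by
  set f : ι → R := fun i ↦ ∑ j ∈ B, N i j
  have hfA : ∀ i ∉ Aᶜ, f i = 0 := fun i hi ↦ sum_eq_zero (hAB i (notMem_compl.1 hi))
  have hsum : ∑ i ∈ Aᶜ, f i = s * #B := calc
    _ = ∑ i, ∑ j ∈ B, N i j := sum_subset (subset_univ _) fun i _ ↦ hfA i
    _ = ∑ j ∈ B, ∑ i, N i j := sum_comm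
    _ = s * #B := by simp only [hs, sum_const, nsmul_eq_mul, mul_comm]
  have hsq : ∑ i ∈ Aᶜ, f i ^ 2 = #B * (r + q * #B) := calc
    _ = ∑ i, ∑ j ∈ B, ∑ j' ∈ B, N i j * N i j' := by
      rw [sum_subset (subset_univ _) fun i _ hi ↦ by rw [hfA i hi, zero_pow two_ne_zero]]
      simp only [f, sq, sum_mul_sum]
    _ = ∑ j ∈ B, ∑ j' ∈ B, (Nᵀ * N) j j' := by
      rw [sum_comm]
      refine sum_congr rfl fun _ _ ↦ ?_
      rw [sum_comm]
      simp only [mul_apply, transpose_apply]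
    _ = ∑ _ ∈ B, (r + q * #B) := sum_congr rfl fun _ hj ↦ by
      simp [hN, sum_add_distrib, one_apply, hj, mul_comm]
    _ = #B * (r + q * #B) := by rw [sum_const, nsmul_eq_mul]
  have hcs := sq_sum_le_card_mul_sum_sq (s := Aᶜ) (f := f)
  rw [hsum, hsq] at hcs
  have hpos : (0 : R) < #B := by exact_mod_cast hB.card_pos
  refine le_of_mul_le_mul_right ?_ hpos
  linarith

variable {V : Type*} {G : SimpleGraph V} [DecidableRel G.Adj]

variable (G) in
/-- The matrix `2 Adj - t I`. For `t = ℓ - μ` it completes the square in the quadratic equation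
satisfied by the adjacency matrix of a strongly regular graph. -/
def shiftedAdjMatrix {R : Type*} [CommRing R] [DecidableEq V] (t : R) : Matrix V V R :=
  (2 : R) • G.adjMatrix R - t • 1

theorem shiftedAdjMatrix_apply_of_compl_adj {R : Type*} [CommRing R] [DecidableEq V] {x y : V}
    (hxy : Gᶜ.Adj x y) (t : R) : shiftedAdjMatrix G t x y = 0 := by
  simp only [shiftedAdjMatrix, Matrix.sub_apply, Matrix.smul_apply, SimpleGraph.adjMatrix_apply,
    one_apply_ne hxy.1, if_neg hxy.2, smul_zero, sub_zero]

variable [Fintype V] {n k ℓ μ : ℕ}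

theorem adjMatrix_mul_self [DecidableEq V] (R : Type*) [Ring R] (h : G.IsSRGWith n k ℓ μ) :
    G.adjMatrix R * G.adjMatrix R =
      ((k : R) - μ) • 1 + ((ℓ : R) - μ) • G.adjMatrix R + (μ : R) • of fun _ _ ↦ 1 := by
  rw [← sq, h.matrix_eq]
  ext x y
  simp only [Matrix.add_apply, Matrix.smul_apply, of_apply, SimpleGraph.adjMatrix_apply]
  obtain rfl | hxy := eq_or_ne x y
  · simp
  · by_cases hadj : G.Adj x y <;> simp [hxy, hadj]

theorem int_param_eq [Nonempty V] (h : G.IsSRGWith n k ℓ μ) :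
    (k : ℤ) * (k - ℓ - 1) = (n - k - 1) * μ := by
  classical
  obtain ⟨x⟩ := ‹Nonempty V›
  have hA : G.adjMatrix ℤ *ᵥ Function.const V 1 = Function.const V (k : ℤ) := by
    ext x
    simp [h.regular x]
  have hJ : (of fun _ _ ↦ (1 : ℤ)) *ᵥ Function.const V 1 = Function.const V (n : ℤ) := by
    ext x
    simp [mulVec, dotProduct, h.card]
  have hrow := congrFun (congrArg (· *ᵥ Function.const V 1) (adjMatrix_mul_self ℤ h)) x
  simp only [← mulVec_mulVec, add_mulVec, smul_mulVec, one_mulVec, hA, hJ, Pi.add_apply,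
    Pi.smul_apply, SimpleGraph.adjMatrix_mulVec_const_apply_of_regular h.regular,
    Function.const_apply, smul_eq_mul] at hrow
  linear_combination hrow

theorem mu_pos_of_lt [Nonempty V] (h : G.IsSRGWith n k ℓ μ) (hℓ : ℓ + 1 < k) : 0 < μ := by
  have hparam := int_param_eq h
  by_contra! hμ
  obtain rfl : μ = 0 := by omega
  have hpos : (0 : ℤ) < k * (k - ℓ - 1) := mul_pos (by omega) (by omega)
  rw [hparam] at hpos
  simp at hpos

theorem two_mul_lt_card_add [Nonempty V] (h : G.IsSRGWith n k ℓ μ) (hℓ : ℓ + 1 < k) (hμ : μ < k) :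
    2 * k < n + ℓ := by
  have hparam := int_param_eq h
  by_contra! hle
  have hfar : ((n : ℤ) - k - 1) * μ ≤ (k - ℓ - 1) * μ :=
    mul_le_mul_of_nonneg_right (by omega) (by omega)
  have hnear : ((k : ℤ) - ℓ - 1) * μ < (k - ℓ - 1) * k :=
    mul_lt_mul_of_pos_left (by omega) (by omega)
  linarith

theorem sum_shiftedAdjMatrix_apply {R : Type*} [CommRing R] [DecidableEq V]
    (h : G.IsRegularOfDegree k) (t : R) (y : V) :
    ∑ x, shiftedAdjMatrix G t x y = 2 * k - t := by
  have hdeg : ∑ x, G.adjMatrix R x y = k := by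
    simp [SimpleGraph.adjMatrix_apply, G.adj_comm _ y, sum_boole,
      ← SimpleGraph.neighborFinset_eq_filter, h y]
  simp only [shiftedAdjMatrix, Matrix.sub_apply, Matrix.smul_apply, sum_sub_distrib, ← smul_sum,
    hdeg]
  simp [one_apply]

theorem shiftedAdjMatrix_transpose_mul_self (R : Type*) [CommRing R] [DecidableEq V]
    (h : G.IsSRGWith n k ℓ μ) :
    (shiftedAdjMatrix G (ℓ - μ : R))ᵀ * shiftedAdjMatrix G (ℓ - μ : R) =
      ((ℓ - μ : R) ^ 2 + 4 * (k - μ)) • 1 + (4 * μ : R) • of fun _ _ ↦ 1 := by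
  set t : R := ℓ - μ
  have hsq : (shiftedAdjMatrix G t)ᵀ * shiftedAdjMatrix G t =
      (4 : R) • (G.adjMatrix R * G.adjMatrix R) - (4 * t) • G.adjMatrix R + t ^ 2 • 1 := by
    simp only [shiftedAdjMatrix, transpose_sub, transpose_smul, SimpleGraph.transpose_adjMatrix,
      transpose_one, sub_mul, mul_sub, smul_mul_assoc, mul_smul_comm, one_mul, mul_one]
    module
  rw [hsq, adjMatrix_mul_self R h]
  module

theorem four_mul_card_mul_card_le [DecidableEq V] (h : G.IsSRGWith n k ℓ μ) {A B : Finset V}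
    (hB : B.Nonempty) (hAB : Gᶜ.IsCompleteBetween A B) :
    4 * (μ : ℤ) * #A * #B ≤ (((ℓ : ℤ) - μ) ^ 2 + 4 * (k - μ)) * #(A ∪ B)ᶜ := by
  have : Nonempty V := hB.to_type
  have hcs := sq_colSum_mul_card_le (shiftedAdjMatrix_transpose_mul_self ℤ h)
    (sum_shiftedAdjMatrix_apply h.regular _) hB
    fun i hi j hj ↦ shiftedAdjMatrix_apply_of_compl_adj (hAB hi hj) _
  have hA : (#Aᶜ : ℤ) = n - #A := by
    rw [← h.card, ← card_add_card_compl A]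
    push_cast
    ring
  have hS : (#(A ∪ B)ᶜ : ℤ) = n - #A - #B := by
    have hdisj : Disjoint A B := disjoint_coe.1 hAB.disjoint
    rw [← h.card, ← card_add_card_compl (A ∪ B), card_union_of_disjoint hdisj]
    push_cast
    ring
  have hparam := int_param_eq h
  rw [hA] at hcs
  rw [hS]
  linear_combination hcs - 4 * #B * hparam

end CauchySchwarz

section LowerBound

theorem discrim_mul_lt_of_param_eq {k ℓ μ a b s : ℤ} (hℓ₀ : 0 ≤ ℓ) (hℓ : 4 * ℓ ≤ k) (hμ₀ : 0 < μ)
    (hμ : 4 * μ ≤ k) (hs₀ : 0 ≤ s) (hs : s + ℓ + 3 ≤ 2 * k) (ha : k + 6 ≤ 2 * a)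
    (hb : k + 6 ≤ 2 * b) (hparam : k * (k - ℓ - 1) = (a + b + s - k - 1) * μ) :
    ((ℓ - μ) ^ 2 + 4 * (k - μ)) * s < 4 * μ * a * b := by
  have hk : 4 ≤ k := by omega
  have hsq : 16 * (ℓ - μ) ^ 2 ≤ k ^ 2 := by
    linarith [sq_le_sq' (a := 4 * (ℓ - μ)) (b := k) (by omega) (by omega)]
  have hupper : 16 * (((ℓ - μ) ^ 2 + 4 * (k - μ)) * s) ≤ (k ^ 2 + 64 * k - 64) * (2 * k - 3) := by
    rw [← mul_assoc]
    exact mul_le_mul (by linarith) (by omega) hs₀ (by nlinarith)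
  -- With `a + b` and then `s` eliminated, the right side is decreasing in `ℓ` and in `μ`; the left
  -- side is its value at `ℓ = μ = k / 4`.
  have hshores : 7 * k ^ 2 - 12 * k ≤ 8 * (μ * (2 * (a + b) - (k + 6))) := by
    have hμs : μ * s ≤ μ * (2 * k - ℓ - 3) := by gcongr; omega
    have h₁ : 0 ≤ (k - 4 * ℓ) * (k - μ) := mul_nonneg (by omega) (by omega)
    have h₂ : 0 ≤ (k - 4 * μ) * (5 * k - 4) := mul_nonneg (by omega) (by omega)
    linarith
  have hprod : (k + 6) * (2 * (a + b) - (k + 6)) ≤ 4 * (a * b) := by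
    linarith [mul_nonneg (sub_nonneg.2 ha) (sub_nonneg.2 hb)]
  have hlower : (k + 6) * (7 * k ^ 2 - 12 * k) ≤ 8 * (4 * μ * a * b) := calc
    _ ≤ (k + 6) * (8 * (μ * (2 * (a + b) - (k + 6)))) := by gcongr
    _ = 8 * (μ * ((k + 6) * (2 * (a + b) - (k + 6)))) := by ring
    _ ≤ 8 * (μ * (4 * (a * b))) := by gcongr
    _ = _ := by ring
  have hcubic : (k ^ 2 + 64 * k - 64) * (2 * k - 3) < 2 * ((k + 6) * (7 * k ^ 2 - 12 * k)) := by
    nlinarith [mul_nonneg (sub_nonneg.2 hk) (sq_nonneg k),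
      mul_nonneg (sub_nonneg.2 hk) (sq_nonneg (k - 4))]
  linarith

variable {V : Type*} [Fintype V] {G : SimpleGraph V} [DecidableRel G.Adj] {n k ℓ μ : ℕ}

theorem two_mul_le_card_compl_union [DecidableEq V] (h : G.IsSRGWith n k ℓ μ)
    (hmax : 4 * max ℓ μ ≤ k) {A B : Finset V} (hAB : Gᶜ.IsCompleteBetween A B)
    (hA : ∃ x ∈ A, ∃ y ∈ A, G.Adj x y) (hB : ∃ x ∈ B, ∃ y ∈ B, G.Adj x y) :
    2 * k ≤ #(A ∪ B)ᶜ + ℓ + 2 := by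
  by_contra! hlt
  obtain ⟨x, hx, x', hx', hxx'⟩ := hA
  obtain ⟨y, hy, y', hy', hyy'⟩ := hB
  have : Nonempty V := ⟨x⟩
  have hBc := three_mul_le_card_compl h hAB hx hx' hxx' hlt
  have hAc := three_mul_le_card_compl h (Gᶜ.isCompleteBetween_comm.1 hAB) hy hy' hyy'
    (by rwa [union_comm])
  have hcard : #A + #B + #(A ∪ B)ᶜ = n := by
    rw [← card_union_of_disjoint (disjoint_coe.1 hAB.disjoint), card_add_card_compl, h.card]
  have hA : #A + #Aᶜ = n := by rw [card_add_card_compl, h.card]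
  have hB : #B + #Bᶜ = n := by rw [card_add_card_compl, h.card]
  have hμ : 0 < μ := mu_pos_of_lt h (by omega)
  refine (four_mul_card_mul_card_le h ⟨y, hy⟩ hAB).not_gt (discrim_mul_lt_of_param_eq
    (by omega) (by omega) (by omega) (by omega) (by omega) (by omega) (by omega) (by omega) ?_)
  rw [int_param_eq h, ← hcard]
  push_cast
  rfl

theorem two_mul_le_card_of_disconnectsIntoNonsingletons (h : G.IsSRGWith n k ℓ μ)
    (hmax : 4 * max ℓ μ ≤ k) {S : Finset V} (hS : G.DisconnectsIntoNonsingletons S) :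
    2 * k ≤ #S + ℓ + 2 := by
  classical
  obtain ⟨⟨A, B, ⟨x, hx⟩, ⟨y, hy⟩, hAB, hunion⟩, hadj⟩ := disconnectsIntoNonsingletons_iff.1 hS
  lift A to Finset V using A.toFinite
  lift B to Finset V using B.toFinite
  have hcompl : (A ∪ B)ᶜ = S := by
    rw [compl_eq_comm, ← coe_inj]
    push_cast
    exact hunion.symm
  have hedge : ∀ {A B : Finset V} {a : V}, Gᶜ.IsCompleteBetween A B → (A ∪ B)ᶜ = S → a ∈ A →
      ∃ a ∈ A, ∃ a' ∈ A, G.Adj a a' := by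
    rintro A B a hAB rfl ha
    obtain ⟨a', ha', haa'⟩ := hadj a (by simp [ha])
    have ha'B : a' ∉ B := fun hb ↦ (hAB ha hb).2 haa'
    exact ⟨a, ha, a', by simpa [ha'B] using ha', haa'⟩
  rw [← hcompl]
  exact two_mul_le_card_compl_union h hmax hAB (hedge hAB hcompl hx)
    (hedge (Gᶜ.isCompleteBetween_comm.1 hAB) (union_comm A B ▸ hcompl) hy)

end LowerBound

section UpperBound

variable {V : Type*} [Fintype V] {G : SimpleGraph V} [DecidableRel G.Adj] {n k ℓ μ : ℕ} {x y : V}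

theorem exists_not_adj_of_adj (h : G.IsSRGWith n k ℓ μ) (hℓ : ℓ + 1 < k) (hμ : μ < k)
    (hxy : G.Adj x y) : ∃ z, ¬ G.Adj x z ∧ ¬ G.Adj y z := by
  classical
  have : Nonempty V := ⟨x⟩
  have hn := two_mul_lt_card_add h hℓ hμ
  have hunion := card_union_neighborFinset_add h hxy
  obtain ⟨z, -, hz⟩ : ∃ z ∈ univ, z ∉ G.neighborFinset x ∪ G.neighborFinset y :=
    exists_mem_notMem_of_card_lt_card (by rw [card_univ, h.card]; omega)
  exact ⟨z, by simpa using hz⟩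

variable [DecidableEq V]

theorem exists_adj_notMem_edgeNeighborhood (h : G.IsSRGWith n k ℓ μ) (hμ : 2 * μ < k)
    (hxy : G.Adj x y) {w : V} (hw : w ∉ edgeNeighborhood G x y) :
    ∃ z ∉ edgeNeighborhood G x y, G.Adj w z := by
  by_contra! hN
  simp only [mem_edgeNeighborhood, not_and_or, not_or, not_not] at hw hN
  have hwx : w ≠ x := by
    rintro rfl
    exact hN y (by simp) hxy
  have hwy : w ≠ y := by
    rintro rfl
    exact hN x (by simp) hxy.symm
  obtain ⟨hxw, hyw⟩ : ¬ G.Adj x w ∧ ¬ G.Adj y w := by tauto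
  have hcover : G.neighborFinset w ⊆ (G.neighborFinset x ∩ G.neighborFinset w) ∪
      (G.neighborFinset y ∩ G.neighborFinset w) := fun z hz ↦ by
    have hwz : G.Adj w z := by simpa using hz
    have := mt (hN z) (not_not_intro hwz)
    simp only [mem_union, mem_inter, SimpleGraph.mem_neighborFinset]
    tauto
  have hcard := (card_le_card hcover).trans (card_union_le _ _)
  rw [card_inter_neighborFinset, card_inter_neighborFinset, h.of_not_adj hwx.symm hxw,
    h.of_not_adj hwy.symm hyw, G.card_neighborFinset_eq_degree, h.regular w] at hcard
  omega

theorem disconnectsIntoNonsingletons_edgeNeighborhood (h : G.IsSRGWith n k ℓ μ) (hℓ : ℓ + 1 < k)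
    (hμ : 2 * μ < k) (hxy : G.Adj x y) :
    G.DisconnectsIntoNonsingletons (edgeNeighborhood G x y) := by
  refine disconnectsIntoNonsingletons_iff.2
    ⟨?_, fun w ↦ exists_adj_notMem_edgeNeighborhood h hμ hxy⟩
  obtain ⟨z, hxz, hyz⟩ := exists_not_adj_of_adj h hℓ (by omega) hxy
  refine ⟨{x, y}, {w | ¬ G.Adj x w ∧ ¬ G.Adj y w}, ⟨x, by simp⟩, ⟨z, hxz, hyz⟩, ?_, ?_⟩
  · rintro a (rfl | rfl) b ⟨hb, hb'⟩
    · exact ⟨fun hab ↦ hb' (hab ▸ hxy.symm), hb⟩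
    · exact ⟨fun hab ↦ hb (hab ▸ hxy), hb'⟩
  · ext w
    simp only [Set.mem_union, Set.mem_insert_iff, Set.mem_singleton_iff, Set.mem_ofPred_eq,
      Set.mem_compl_iff, mem_coe, mem_edgeNeighborhood]
    tauto

end UpperBound

end KappaTwo

theorem mainTheorem1 {V : Type*} [Fintype V] [DecidableEq V] (G : SimpleGraph V)
    [DecidableRel G.Adj] (v k l m : ℕ) (hsrg : G.IsSRGWith v k l m) (hconn : G.Connected)
    (hnc : G ≠ ⊤) (hmax : ((max l m : ℕ) : ℝ) ≤ (k : ℝ) / 4) :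
    G.IsKappaTwo (2 * (k : ℤ) - (l : ℤ) - 2) := by
  have hmax' : 4 * max l m ≤ k := by
    have : 4 * ((max l m : ℕ) : ℝ) ≤ k := by linarith
    exact_mod_cast this
  have hm : 0 < m := KappaTwo.mu_pos_of_connected hsrg hconn hnc
  constructor
  · obtain ⟨x⟩ := hconn.nonempty
    obtain ⟨y, hxy⟩ : ∃ y, G.Adj x y := by
      rw [← G.degree_pos_iff_exists_adj, hsrg.regular x]
      omega
    refine ⟨_, KappaTwo.disconnectsIntoNonsingletons_edgeNeighborhood hsrg (by omega) (by omega)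
      hxy, ?_⟩
    have := KappaTwo.card_edgeNeighborhood_add hsrg hxy
    omega
  · rintro _ ⟨S, hS, rfl⟩
    have := KappaTwo.two_mul_le_card_of_disconnectsIntoNonsingletons hsrg hmax' hS
    omega
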